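/- Let $X$ be a reduced proper curve over a field $k$ which is the union of three smooth irreducible curves $X_1,X_2,X_3$, such that $X_1$ and $X_2$ meet transversally at exactly one point $A$, $X_2$ and $X_3$ meet transversally at exactly one point $B\neq A$, and $X_1\cap X_3=\emptyset$. Fix invertible sheaves $\mathcal{O}_{(X_1)},\mathcal{O}_{(X_2)},\mathcal{O}_{(X_3)}$ on $X$ whose restrictions to $(X_1,X_2,X_3)$ are $(\mathcal{O}_{X_1}(-A),\mathcal{O}_{X_2}(A),\mathcal{O}_{X_3})$, $(\mathcal{O}_{X_1}(A),\mathcal{O}_{X_2}(-A-B),\mathcal{O}_{X_3}(B))$ and $(\mathcal{O}_{X_1},\mathcal{O}_{X_2}(B),\mathcal{O}_{X_3}(-B))$, respectively. Let $L$ be an invertible sheaf on $X$ (for instance one of degree $d$ on $X_1$ and degree $0$ on $X_2$ and $X_3$), and for integers $i,l\ge 0$ with $i+l\le d$ put $$L_{(i,d-i-l,l)}:=L\otimes\mathcal{O}_{(X_1)}^{\otimes (d-i)}\otimes(\mathcal{O}_{(X_1)}\otimes\mathcal{O}_{(X_2)})^{\otimes l}.$$ For a subcurve $Y$ and a subspace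 $V\subseteq H^0(X,M)$, with $M$ a sheaf of $\mathcal{O}_X$-modules, let $V^{Y,0}$ be the subspace of the sections in $V$ that vanish on $Y$. Say that the distributivity holds in $V$ if $$V^{X_1,0}\cap(V^{X_2,0}+V^{X_3,0})=V^{X_1,0}\cap V^{X_2,0}+V^{X_1,0}\cap V^{X_3,0}.$$ For a component $X_q$ with $q\in\{1,3\}$, let $X_q^c$ be the union of the other two components. A map $\varphi\colon M\to N$ of invertible sheaves is called a linking map for $X_q$ if it factors as $$M\to M|_{X_q^c}\cong N|_{X_q^c}(-X_q\cap X_q^c)\hookrightarrow N,$$ where the first map is the restriction, the second is an isomorphism, and the last is the natural inclusion (extension by zero). Let $r\ge 0$ be an integer, let $i,l\ge 0$ with $i+l\le d$, and let $\underline d:=(i,d-i-l,l)$. 1. Suppose $i>0$ and let $\underline d'':=(i-1,d-i-l+1,l)$. Let $\varphi_{\underline d,\underline d''}\colon L_{\underline d}\to L_{\underline d''}$ be a linking map for $X_1$, and let $V_{\underline d}\subseteq H^0(L_{\underline d})$ and $V_{\underline d''}\subseteq H^0(L_{\underline d''})$ be $(r+1)$-dimensional subspaces such that $\varphi_{\underline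 d,\underline d''}(V_{\underline d})=V_{\underline d''}^{X_1,0}$. Then the distributivity holds in $V_{\underline d''}$ if and only if $$\dim(V_{\underline d}^{X_2,0}+V_{\underline d}^{X_3,0})-\dim(V_{\underline d''}^{X_2,0}+V_{\underline d''}^{X_3,0})=r+1-\dim(V_{\underline d''}^{X_1,0}+V_{\underline d''}^{X_2,0}+V_{\underline d''}^{X_3,0}).$$ 2. Suppose $i+l\le d-1$ and let $\underline d''':=(i,d-i-l-1,l+1)$. Let $\varphi_{\underline d''',\underline d}\colon L_{\underline d'''}\to L_{\underline d}$ be a linking map for $X_3$, and let $V_{\underline d}\subseteq H^0(L_{\underline d})$ and $V_{\underline d'''}\subseteq H^0(L_{\underline d'''})$ be $(r+1)$-dimensional subspaces such that $\varphi_{\underline d''',\underline d}(V_{\underline d'''})=V_{\underline d}^{X_3,0}$. Then the distributivity holds in $V_{\underline d}$ if and only if $$\dim(V_{\underline d'''}^{X_1,0}+V_{\underline d'''}^{X_2,0})-\dim(V_{\underline d}^{X_1,0}+V_{\underline d}^{X_2,0})=r+1-\dim(V_{\underline d}^{X_1,0}+V_{\underline d}^{X_2,0}+V_{\underline d}^{X_3,0}).$$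 -/

import Mathlib

open CategoryTheory AlgebraicGeometry TopologicalSpace Limits

universe u

noncomputable section

namespace LimitLinear

/-! ### Sheaves of modules on a scheme -/

section Sheaves

variable {X : Scheme.{u}}

/-- The structure sheaf `𝒪_X`, as a sheaf of modules. -/
def structureSheaf (X : Scheme.{u}) : X.Modules :=
  SheafOfModules.unit X.ringCatSheaf

/-- The tensor product `M ⊗ N` of two `𝒪_X`-modules: the sheafification of the presheaf
`U ↦ M(U) ⊗_{𝒪_X(U)} N(U)`. -/
def tensor (M N : X.Modules) : X.Modules :=
  (PresheafOfModules.sheafification (𝟙 X.ringCatSheaf.obj)).obj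
    (PresheafOfModules.Monoidal.tensorObj (R := X.presheaf) M.val N.val)

/-- The tensor power `M^{⊗ n}`. -/
def tensorPow (M : X.Modules) : ℕ → X.Modules
  | 0 => structureSheaf X
  | n + 1 => tensor (tensorPow M n) M

/-- An invertible sheaf: every point has an open neighbourhood on which the sheaf is isomorphic
to the structure sheaf. -/
def IsInvertible (M : X.Modules) : Prop :=
  ∀ x : X, ∃ U : X.Opens, x ∈ U ∧ Nonempty (M.restrict U.ι ≅ structureSheaf (U : Scheme.{u}))

/-- A closed subset, as a closed subscheme with its reduced structure. -/
def sub (Z : Closeds X) : Scheme.{u} :=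
  (Scheme.IdealSheafData.vanishingIdeal Z).subscheme

/-- The inclusion of the reduced closed subscheme `Z` in `X`. -/
def subι (Z : Closeds X) : sub Z ⟶ X :=
  (Scheme.IdealSheafData.vanishingIdeal Z).subschemeι

/-- The restriction `M|_Z`, a sheaf on `Z`. -/
def restr (M : X.Modules) (Z : Closeds X) : (sub Z).Modules :=
  (Scheme.Modules.pullback (subι Z)).obj M

/-- A sheaf on `Z`, regarded as a sheaf on `X` that is supported on `Z`. -/
def extend {Z : Closeds X} (N : (sub Z).Modules) : X.Modules :=
  (Scheme.Modules.pushforward (subι Z)).obj N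

/-- The map `extend N ⟶ extend N'` given by a map `N ⟶ N'`. -/
def extendMap {Z : Closeds X} {N N' : (sub Z).Modules} (g : N ⟶ N') : extend N ⟶ extend N' :=
  (Scheme.Modules.pushforward (subι Z)).map g

/-- The restriction map `M ⟶ M|_Z`. -/
def restrMap (M : X.Modules) (Z : Closeds X) : M ⟶ extend (restr M Z) :=
  (Scheme.Modules.pullbackPushforwardAdjunction (subι Z)).unit.app M

/-- The sheaf `M(-D)` of sections of `M` that vanish on the reduced closed subscheme `D`.
It is used for invertible sheaves `M` on smooth or nodal curves, with `D` a finite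
set of smooth points. -/
def minus (M : X.Modules) (D : Closeds X) : X.Modules :=
  kernel (restrMap M D)

/-- The inclusion `M(-D) ⟶ M`. -/
def minusι (M : X.Modules) (D : Closeds X) : minus M D ⟶ M :=
  kernel.ι (restrMap M D)

/-- The intersection `Z ∩ W`, as a closed subset of the scheme `Z`. -/
def trace (Z W : Closeds X) : Closeds (sub Z) :=
  W.preimage (subι Z).continuous

/-- Let `X = Y ∪ Z`, and let `M`, `N` be sheaves on `X`. The map `φ : M ⟶ N` factors as
`M ⟶ M|_Y ≅ N|_Y(-(Z ∩ Y)) ↪ N`. Here the first map is the restriction, the second one is some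
isomorphism of sheaves on `Y`, and the last one is the natural inclusion `j`, which extends
sections by zero: `j` followed by the restriction to `Y` is the inclusion
`N|_Y(-(Z ∩ Y)) ↪ N|_Y`, and `j` followed by the restriction to `Z` is zero. -/
def IsLinkingMap (Z Y : Closeds X) {M N : X.Modules} (φ : M ⟶ N) : Prop :=
  ∃ (e : restr M Y ≅ minus (restr N Y) (trace Y Z))
    (j : extend (minus (restr N Y) (trace Y Z)) ⟶ N),
    j ≫ restrMap N Y = extendMap (minusι (restr N Y) (trace Y Z)) ∧
    j ≫ restrMap N Z = 0 ∧
    φ = restrMap M Y ≫ extendMap e.hom ≫ j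

end Sheaves

/-! ### The curve -/

/-- A curve `X` over the field `k` that is the union of three smooth curves `X₁`, `X₂`, `X₃` such
that `X₁` and `X₂` meet transversally at one point `A`, `X₂` and `X₃` meet transversally at one
point `B ≠ A`, and `X₁`, `X₃` are disjoint. Transversality says that the scheme-theoretic
intersection is the reduced point. -/
structure Curve (k : Type u) [Field k] where
  X : Scheme.{u}
  str : X ⟶ Spec (CommRingCat.of k)
  isProper : IsProper str
  isReduced : IsReduced X
  X₁ : Closeds X
  X₂ : Closeds X
  X₃ : Closeds X
  irreducible₁ : IsIrreducible (X₁ : Set X)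
  irreducible₂ : IsIrreducible (X₂ : Set X)
  irreducible₃ : IsIrreducible (X₃ : Set X)
  smooth₁ : SmoothOfRelativeDimension 1 (subι X₁ ≫ str)
  smooth₂ : SmoothOfRelativeDimension 1 (subι X₂ ≫ str)
  smooth₃ : SmoothOfRelativeDimension 1 (subι X₃ ≫ str)
  union : (X₁ : Set X) ∪ X₂ ∪ X₃ = Set.univ
  A : X
  B : X
  isClosed_A : IsClosed {A}
  isClosed_B : IsClosed {B}
  A_ne_B : A ≠ B
  inter₁₂ : Scheme.IdealSheafData.vanishingIdeal X₁ ⊔ Scheme.IdealSheafData.vanishingIdeal X₂ =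
    Scheme.IdealSheafData.vanishingIdeal ⟨{A}, isClosed_A⟩
  inter₂₃ : Scheme.IdealSheafData.vanishingIdeal X₂ ⊔ Scheme.IdealSheafData.vanishingIdeal X₃ =
    Scheme.IdealSheafData.vanishingIdeal ⟨{B}, isClosed_B⟩
  inter₁₃ : Disjoint (X₁ : Set X) (X₃ : Set X)

namespace Curve

variable {k : Type u} [Field k] (C : Curve k)

/-- The closed subset `{A}`. -/
def ptA : Closeds C.X := ⟨{C.A}, C.isClosed_A⟩

/-- The closed subset `{B}`. -/
def ptB : Closeds C.X := ⟨{C.B}, C.isClosed_B⟩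

/-- The ring homomorphism `k → Γ(X, 𝒪_X)`. -/
def scalar : k →+* Γ(C.X, ⊤) :=
  (C.str.appTop.hom).comp (Scheme.ΓSpecIso (CommRingCat.of k)).inv.hom

/-- The space of global sections `H⁰(X, M)`. -/
def H0 (M : C.X.Modules) : Type u := Γ(M, ⊤)

instance (M : C.X.Modules) : AddCommGroup (C.H0 M) :=
  inferInstanceAs (AddCommGroup Γ(M, ⊤))

/-- `H⁰(X, M)` is a vector space over `k` through `k → Γ(X, 𝒪_X)`. -/
instance (M : C.X.Modules) : Module k (C.H0 M) :=
  letI : Module Γ(C.X, ⊤) (C.H0 M) := inferInstanceAs (Module Γ(C.X, ⊤) Γ(M, ⊤))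
  Module.compHom (C.H0 M) C.scalar

/-- The `k`-linear map `H⁰(X, M) → H⁰(X, N)` given by `φ : M ⟶ N`. -/
def H0map {M N : C.X.Modules} (φ : M ⟶ N) : C.H0 M →ₗ[k] C.H0 N where
  toFun s := (φ.app ⊤).hom s
  map_add' s t := map_add (φ.app ⊤).hom s t
  map_smul' c s := Scheme.Modules.Hom.app_smul φ (C.scalar c) s

variable {C} in
/-- `V^{Z,0}`: the subspace of the sections in `V` that vanish on `Z`, that is, whose restriction
in `H⁰(Z, M|_Z)` is zero. -/
def vanishing {M : C.X.Modules} (V : Submodule k (C.H0 M)) (Z : Closeds C.X) :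
    Submodule k (C.H0 M) :=
  V ⊓ LinearMap.ker (C.H0map (restrMap M Z))

/-- The fixed invertible sheaves `𝒪_(X₁)`, `𝒪_(X₂)`, `𝒪_(X₃)` on `X`, with restrictions
* `𝒪_{X₁}(-A)`, `𝒪_{X₂}(A)`, `𝒪_{X₃}` for `𝒪_(X₁)`,
* `𝒪_{X₁}(A)`, `𝒪_{X₂}(-A-B)`, `𝒪_{X₃}(B)` for `𝒪_(X₂)`,
* `𝒪_{X₁}`, `𝒪_{X₂}(B)`, `𝒪_{X₃}(-B)` for `𝒪_(X₃)`.

That an invertible sheaf `N` on `X_q` is isomorphic to `𝒪(P)` is expressed by `N(-P) ≅ 𝒪`. -/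
structure Twists where
  O₁ : C.X.Modules
  O₂ : C.X.Modules
  O₃ : C.X.Modules
  invertible₁ : IsInvertible O₁
  invertible₂ : IsInvertible O₂
  invertible₃ : IsInvertible O₃
  restr₁₁ : Nonempty (restr O₁ C.X₁ ≅ minus (structureSheaf (sub C.X₁)) (trace C.X₁ C.ptA))
  restr₁₂ : Nonempty (minus (restr O₁ C.X₂) (trace C.X₂ C.ptA) ≅ structureSheaf (sub C.X₂))
  restr₁₃ : Nonempty (restr O₁ C.X₃ ≅ structureSheaf (sub C.X₃))
  restr₂₁ : Nonempty (minus (restr O₂ C.X₁) (trace C.X₁ C.ptA) ≅ structureSheaf (sub C.X₁))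
  restr₂₂ : Nonempty
    (restr O₂ C.X₂ ≅ minus (structureSheaf (sub C.X₂)) (trace C.X₂ (C.ptA ⊔ C.ptB)))
  restr₂₃ : Nonempty (minus (restr O₂ C.X₃) (trace C.X₃ C.ptB) ≅ structureSheaf (sub C.X₃))
  restr₃₁ : Nonempty (restr O₃ C.X₁ ≅ structureSheaf (sub C.X₁))
  restr₃₂ : Nonempty (minus (restr O₃ C.X₂) (trace C.X₂ C.ptB) ≅ structureSheaf (sub C.X₂))
  restr₃₃ : Nonempty (restr O₃ C.X₃ ≅ minus (structureSheaf (sub C.X₃)) (trace C.X₃ C.ptB))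

variable {C} in
/-- For `i + l ≤ d`, the sheaf
`L_{(i, d-i-l, l)} = L ⊗ 𝒪_(X₁)^{⊗ (d-i)} ⊗ 𝒪_(-X₃)^{⊗ l}`, where
`𝒪_(-X₃) = 𝒪_(X₁) ⊗ 𝒪_(X₂)`. -/
def Twists.sheaf (T : C.Twists) (L : C.X.Modules) (d i l : ℕ) : C.X.Modules :=
  tensor (tensor L (tensorPow T.O₁ (d - i))) (tensorPow (tensor T.O₁ T.O₂) l)

end Curve

/-- `V₁` distributes over `V₂` and `V₃`. -/
def DistributesOver {k V : Type*} [Field k] [AddCommGroup V] [Module k V]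
    (V₁ V₂ V₃ : Submodule k V) : Prop :=
  V₁ ⊓ (V₂ ⊔ V₃) = (V₁ ⊓ V₂) ⊔ (V₁ ⊓ V₃)

/-- The distributivity holds in `V`. -/
def Distributivity {k : Type u} [Field k] {C : Curve k} {M : C.X.Modules}
    (V : Submodule k (C.H0 M)) : Prop :=
  DistributesOver (Curve.vanishing V C.X₁) (Curve.vanishing V C.X₂) (Curve.vanishing V C.X₃)

end LimitLinear

end

/-! Let `Z` be the component of the linking map `φ : M ⟶ N`, let `W`, `W'` be the other two, and put
`E = V`, `F = V'`, so that `φ(E) = F^{Z,0}`.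

Geometry: restricted to `W ∪ W'`, a linking map is an isomorphism followed by the inclusion of the
sections vanishing on `Z`, hence an isomorphism off `Z`. Since `W` is integral, `W ⊄ Z` and `M` is
invertible, a section `s` of `M` vanishes on `W` as soon as it vanishes on `W \ Z`, so `s` vanishes
on `W` if and only if `φ(s)` does (`restrMap_app_eq_zero_iff_of_isLinkingMap`). Thus `E^{W,0}` is
the preimage of `F^{W,0}` in `E`, and likewise for `W'`.

Linear algebra (`distributesOver_iff_finrank`): write `F₁`, `F₂`, `F₃` for the sections in `F`
vanishing on `Z`, `W`, `W'`, and `E₂`, `E₃` for the preimages of `F₂`, `F₃`. Both `E` and `E₂ + E₃`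
contain the kernel of `φ` on `E`, so rank-nullity gives `dim E - dim (E₂ + E₃) = dim F₁ - dim (F₁ ∩
F₂ + F₁ ∩ F₃)`. Grassmann's formula computes `dim F₁ ∩ (F₂ + F₃)`. One inclusion in the distributive
law always holds, so the law is the equality of these two dimensions, which rearranges to the stated
formula.

The invertibility of the twisted sheaves comes from local frames (`isInvertible_tensor`). -/

noncomputable section

namespace LimitLinear

/-! ### Dimension count for distributivity -/

section LinearAlgebra

variable {k V W : Type*} [Field k] [AddCommGroup V] [Module k V] [AddCommGroup W] [Module k W]

/-- Let `f` map the subspace `E` onto `F₁ ≤ F`, and let `E₂`, `E₃` be the preimages in `E` of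
`F₂`, `F₃`. Then the distributivity of `F₁` over `F₂`, `F₃` is a condition on dimensions. -/
theorem distributesOver_iff_finrank (f : V →ₗ[k] W) (E E₂ E₃ : Submodule k V)
    (F F₁ F₂ F₃ : Submodule k W) [FiniteDimensional k E] [FiniteDimensional k F]
    (hEF : Module.finrank k E = Module.finrank k F)
    (h₁F : F₁ ≤ F) (h₂F : F₂ ≤ F) (h₃F : F₃ ≤ F) (hmap : E.map f = F₁)
    (h₂ : E₂ = E ⊓ F₂.comap f) (h₃ : E₃ = E ⊓ F₃.comap f) :
    DistributesOver F₁ F₂ F₃ ↔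
      (Module.finrank k ↥(E₂ ⊔ E₃) : ℤ) - Module.finrank k ↥(F₂ ⊔ F₃) =
        Module.finrank k E - Module.finrank k ↥(F₁ ⊔ F₂ ⊔ F₃) := by
  have fd : ∀ G : Submodule k W, G ≤ F → FiniteDimensional k G := fun G hG =>
    Submodule.finiteDimensional_of_le hG
  have fdE : ∀ G : Submodule k V, G ≤ E → FiniteDimensional k G := fun G hG =>
    Submodule.finiteDimensional_of_le hG
  have := fd F₁ h₁F
  have := fd (F₂ ⊔ F₃) (sup_le h₂F h₃F)
  have := fd (F₁ ⊓ (F₂ ⊔ F₃)) (inf_le_left.trans h₁F)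
  have h₂E : E₂ ≤ E := h₂ ▸ inf_le_left
  have h₃E : E₃ ≤ E := h₃ ▸ inf_le_left
  have := fdE (E₂ ⊔ E₃) (sup_le h₂E h₃E)
  -- Rank-nullity on `G`: the bounds on `G` make its kernel the same as that of `E`, so it cancels
  -- when `E` and `E₂ ⊔ E₃` are compared.
  have rank_map : ∀ G : Submodule k V, G ≤ E → LinearMap.ker f ⊓ E ≤ G →
      Module.finrank k (G.map f) + Module.finrank k ↥(LinearMap.ker f ⊓ E) =
        Module.finrank k G := by
    intro G hG hker
    have := fdE G hG
    have key := LinearMap.finrank_range_add_finrank_ker (f.domRestrict G)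
    have e1 : LinearMap.range (f.domRestrict G) = G.map f := LinearMap.range_domRestrict G f
    have e2 : Module.finrank k (LinearMap.ker (f.domRestrict G)) =
        Module.finrank k ↥(LinearMap.ker f ⊓ E) := by
      have : (LinearMap.ker (f.domRestrict G)).map G.subtype = LinearMap.ker f ⊓ E := by
        rw [LinearMap.ker_domRestrict, Submodule.map_comap_subtype, inf_comm]
        exact le_antisymm (inf_le_inf_left _ hG) (le_inf inf_le_left hker)
      rw [← this]
      exact (LinearEquiv.finrank_eq (Submodule.equivMapOfInjective _ G.injective_subtype _))
    rw [e1, e2] at key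
    exact key
  have map_inf : ∀ G : Submodule k W, (E ⊓ G.comap f).map f = F₁ ⊓ G := by
    intro G
    rw [← hmap]
    refine le_antisymm (le_inf (Submodule.map_mono inf_le_left)
      ((Submodule.map_mono inf_le_right).trans (Submodule.map_comap_le f G))) ?_
    rintro _ ⟨⟨x, hx, rfl⟩, hG⟩
    exact ⟨x, ⟨hx, hG⟩, rfl⟩
  have hmap' : (E₂ ⊔ E₃).map f = F₁ ⊓ F₂ ⊔ F₁ ⊓ F₃ := by
    rw [Submodule.map_sup, h₂, h₃, map_inf, map_inf]
  have r1 := rank_map E le_rfl inf_le_right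
  have r2 := rank_map (E₂ ⊔ E₃) (sup_le h₂E h₃E) (le_sup_of_le_left (by
    rw [h₂]
    exact fun x hx => ⟨hx.2, by simp [LinearMap.mem_ker.1 hx.1]⟩))
  rw [hmap] at r1
  rw [hmap'] at r2
  have r3 := Submodule.finrank_sup_add_finrank_inf_eq F₁ (F₂ ⊔ F₃)
  rw [← sup_assoc] at r3
  have hle : F₁ ⊓ F₂ ⊔ F₁ ⊓ F₃ ≤ F₁ ⊓ (F₂ ⊔ F₃) := le_inf_sup
  have : DistributesOver F₁ F₂ F₃ ↔ Module.finrank k ↥(F₁ ⊓ F₂ ⊔ F₁ ⊓ F₃) =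
      Module.finrank k ↥(F₁ ⊓ (F₂ ⊔ F₃)) := by
    unfold DistributesOver
    constructor
    · intro h; rw [h]
    · intro h; exact (Submodule.eq_of_le_of_finrank_eq hle h).symm
  rw [this]
  omega

/-- In a modular lattice the distributive law for a triple does not depend on which member is
singled out. This is needed because the linking map for `X₃` yields the law with `X₃` in the first
place. -/
theorem DistributesOver.rotate {k V : Type*} [Field k] [AddCommGroup V] [Module k V]
    {V₁ V₂ V₃ : Submodule k V} (h : DistributesOver V₁ V₂ V₃) : DistributesOver V₃ V₁ V₂ := by
  unfold DistributesOver at h ⊢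
  -- The modular law with `V₂ ≤ V₂ ⊔ V₃`, then the hypothesis; the summand `V₁ ⊓ V₂` is absorbed by
  -- `V₂`.
  have h' : (V₂ ⊔ V₃) ⊓ (V₁ ⊔ V₂) = V₂ ⊔ V₁ ⊓ V₃ := by
    rw [inf_comm (V₂ ⊔ V₃), sup_comm V₁ V₂, sup_inf_assoc_of_le _ le_sup_left, h, ← sup_assoc,
      sup_eq_left.2 (inf_le_right : V₁ ⊓ V₂ ≤ V₂)]
  calc V₃ ⊓ (V₁ ⊔ V₂) = V₃ ⊓ ((V₂ ⊔ V₃) ⊓ (V₁ ⊔ V₂)) := by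
        rw [← inf_assoc, inf_eq_left.2 (le_sup_right : V₃ ≤ V₂ ⊔ V₃)]
    _ = V₃ ⊓ V₁ ⊔ V₃ ⊓ V₂ := by
        rw [h', sup_comm V₂, inf_comm V₃, sup_inf_assoc_of_le _ inf_le_right, inf_comm V₁,
          inf_comm V₂]

end LinearAlgebra

/-! ### Global sections as morphisms from the structure sheaf, and their pullbacks -/

section Pullback

variable {X Y Z : Scheme.{u}}

open Scheme.Modules

/-- The two morphisms are transposes of each other under the adjunction. As `restrMap` is the unit,
vanishing on a subscheme becomes vanishing of a pullback, a condition that can be followed along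
composites of morphisms of schemes. -/
theorem pullback_map_eq_zero_iff (f : X ⟶ Y) {M N : Y.Modules} (s : M ⟶ N) :
    (Scheme.Modules.pullback f).map s = 0 ↔ s ≫ (pullbackPushforwardAdjunction f).unit.app N = 0 := by
  have h : (pullbackPushforwardAdjunction f).homEquiv _ _ ((Scheme.Modules.pullback f).map s) =
      s ≫ (pullbackPushforwardAdjunction f).unit.app N := by
    rw [Adjunction.homEquiv_unit]
    exact ((pullbackPushforwardAdjunction f).unit.naturality s).symm
  rw [← h, ← ((pullbackPushforwardAdjunction f).homEquiv _ _).apply_eq_iff_eq]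
  rw [show (pullbackPushforwardAdjunction f).homEquiv _ _
      (0 : (Scheme.Modules.pullback f).obj M ⟶ _) = 0 by
    rw [Adjunction.homEquiv_unit, Functor.map_zero, comp_zero]]

theorem pullback_comp_map_eq_zero_iff (f : X ⟶ Y) (g : Y ⟶ Z) {M N : Z.Modules} (s : M ⟶ N) :
    (Scheme.Modules.pullback (f ≫ g)).map s = 0 ↔
      (Scheme.Modules.pullback f).map ((Scheme.Modules.pullback g).map s) = 0 := by
  have h := (pullbackComp f g).hom.naturality s
  constructor
  · intro h0
    rw [h0, comp_zero] at h
    exact (cancel_mono ((pullbackComp f g).hom.app N)).1 (by rw [zero_comp]; exact h)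
  · intro h0
    rw [← cancel_epi ((pullbackComp f g).hom.app M), comp_zero, ← h]
    erw [h0, zero_comp]

theorem restrict_map_eq_zero_iff (f : X ⟶ Y) [IsOpenImmersion f] {M N : Y.Modules} (s : M ⟶ N) :
    (Scheme.Modules.pullback f).map s = 0 ↔ (restrictFunctor f).map s = 0 := by
  have h := (restrictFunctorIsoPullback f).hom.naturality s
  constructor
  · intro h0
    rw [h0, comp_zero] at h
    exact (cancel_mono ((restrictFunctorIsoPullback f).hom.app N)).1 (by rw [zero_comp]; exact h)
  · intro h0
    rw [← cancel_epi ((restrictFunctorIsoPullback f).hom.app M), comp_zero, ← h, h0, zero_comp]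

/-- The morphism `𝒪_X ⟶ M` that corresponds to a global section of `M`. -/
def homOfSection (M : X.Modules) (s : Γ(M, ⊤)) : structureSheaf X ⟶ M :=
  (SheafOfModules.unitHomEquiv (R := X.ringCatSheaf) M).symm
    (PresheafOfModules.sectionsMk (fun U => M.presheaf.map (homOfLE le_top : U.unop ⟶ ⊤).op s)
      (by
        intro U V f
        change (M.presheaf.map _ ≫ M.presheaf.map f) s = _
        rw [← Functor.map_comp]
        rfl))

theorem homOfSection_app (M : X.Modules) (s : Γ(M, ⊤)) (U : X.Opens) (f : Γ(X, U)) :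
    (homOfSection M s).app U f = f • M.presheaf.map (homOfLE le_top : U ⟶ ⊤).op s := rfl

theorem hom_ext_of_one {M : X.Modules} {a b : structureSheaf X ⟶ M}
    (h : a.app ⊤ (1 : Γ(X, ⊤)) = b.app ⊤ (1 : Γ(X, ⊤))) : a = b := by
  apply (SheafOfModules.unitHomEquiv (R := X.ringCatSheaf) M).injective
  refine PresheafOfModules.sections_ext _ _ fun U => ?_
  have key (c : structureSheaf X ⟶ M) : c.app U.unop (1 : Γ(X, U.unop)) =
      M.presheaf.map (homOfLE le_top : U.unop ⟶ ⊤).op (c.app ⊤ (1 : Γ(X, ⊤))) := by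
    have := ConcreteCategory.congr_hom
      (c.mapPresheaf.naturality (homOfLE le_top : U.unop ⟶ ⊤).op) (1 : Γ(X, ⊤))
    refine Eq.trans ?_ this
    change _ = c.app U.unop (X.presheaf.map (homOfLE le_top : U.unop ⟶ ⊤).op 1)
    rw [map_one]
  exact (key a).trans ((congrArg _ h).trans (key b).symm)

theorem homOfSection_comp {M N : X.Modules} (s : Γ(M, ⊤)) (φ : M ⟶ N) :
    homOfSection M s ≫ φ = homOfSection N (φ.app ⊤ s) := by
  apply hom_ext_of_one
  change φ.app ⊤ ((1 : Γ(X, ⊤)) • M.presheaf.map (𝟙 _) s) =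
    (1 : Γ(X, ⊤)) • N.presheaf.map (𝟙 _) (φ.app ⊤ s)
  simp

theorem hom_app_apply {M : X.Modules} (φ : structureSheaf X ⟶ M) (U : X.Opens) (f : Γ(X, U)) :
    φ.app U f = f • M.presheaf.map (homOfLE le_top : U ⟶ ⊤).op (φ.app ⊤ (1 : Γ(X, ⊤))) := by
  have : φ = homOfSection M (φ.app ⊤ (1 : Γ(X, ⊤))) := by
    apply hom_ext_of_one
    change φ.app ⊤ (1 : Γ(X, ⊤)) =
      (1 : Γ(X, ⊤)) • M.presheaf.map (𝟙 _) (φ.app ⊤ (1 : Γ(X, ⊤)))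
    simp
  exact (congrArg (fun c : structureSheaf X ⟶ M => c.app U f) this).trans
    (homOfSection_app _ _ _ _)

theorem homOfSection_eq_zero_iff {M : X.Modules} (s : Γ(M, ⊤)) :
    homOfSection M s = 0 ↔ s = 0 := by
  constructor
  · intro h
    have : (homOfSection M s).app ⊤ (1 : Γ(X, ⊤)) = 0 := by rw [h]; rfl
    rw [homOfSection_app, one_smul] at this
    change M.presheaf.map (𝟙 _) s = 0 at this
    simpa using this
  · rintro rfl
    apply hom_ext_of_one
    rw [homOfSection_app, map_zero, smul_zero]
    rfl

/-- A global section vanishes on `Z` if and only if the corresponding morphism `𝒪_X ⟶ M`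
vanishes after pulling back to `Z`. -/
theorem restrMap_app_eq_zero_iff {M : X.Modules} (s : Γ(M, ⊤)) (Z : Closeds X) :
    (restrMap M Z).app ⊤ s = 0 ↔
      (Scheme.Modules.pullback (subι Z)).map (homOfSection M s) = 0 := by
  rw [pullback_map_eq_zero_iff, ← homOfSection_eq_zero_iff, ← homOfSection_comp]
  rfl

end Pullback

/-! ### Reduced closed subschemes -/

section Subschemes

variable {X : Scheme.{u}}

theorem range_subι (Z : Closeds X) : Set.range (subι Z) = Z := by
  refine (Scheme.IdealSheafData.range_subschemeι _).trans ?_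
  simp

instance isReduced_sub (Z : Closeds X) : IsReduced (sub Z) := by
  apply +allowSynthFailures @IsReduced.of_openCover (sub Z)
    (Scheme.IdealSheafData.vanishingIdeal Z).subschemeCover.openCover
  intro (U : X.affineOpens)
  have : _root_.IsReduced (CommRingCat.of
      ((X.presheaf.obj (.op U.1)) ⧸ (Scheme.IdealSheafData.vanishingIdeal Z).ideal U)) := by
    change _root_.IsReduced
      ((X.presheaf.obj (.op U.1)) ⧸ (Scheme.IdealSheafData.vanishingIdeal Z).ideal U)
    rw [← Ideal.isRadical_iff_quotient_reduced, Scheme.IdealSheafData.vanishingIdeal_ideal]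
    exact PrimeSpectrum.isRadical_vanishingIdeal _
  exact inferInstanceAs (IsReduced (Spec (CommRingCat.of
    ((X.presheaf.obj (.op U.1)) ⧸ (Scheme.IdealSheafData.vanishingIdeal Z).ideal U))))

/-- The support of a sum of ideal sheaves is the intersection of the supports. This places `A` and
`B` on the components. -/
theorem mem_of_vanishingIdeal_sup_eq {Z W : Closeds X} {x : X}
    (hx : IsClosed {x})
    (h : Scheme.IdealSheafData.vanishingIdeal Z ⊔ Scheme.IdealSheafData.vanishingIdeal W =
      Scheme.IdealSheafData.vanishingIdeal ⟨{x}, hx⟩) : x ∈ Z ∧ x ∈ W := by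
  have h' := congrArg (fun I => (I.support : Set X)) h
  simp only [Scheme.IdealSheafData.support_sup, Closeds.coe_inf,
    Scheme.IdealSheafData.coe_support_vanishingIdeal] at h'
  exact h'.ge (Set.mem_singleton x)

theorem isIntegral_sub {Z : Closeds X} (hZ : IsIrreducible (Z : Set X)) : IsIntegral (sub Z) := by
  have hemb : Topology.IsEmbedding (subι Z) :=
    Scheme.Hom.isEmbedding (Scheme.IdealSheafData.vanishingIdeal Z).subschemeι
  have : IrreducibleSpace (Set.range (subι Z)) := by
    rw [range_subι]
    exact Subtype.irreducibleSpace hZ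
  have : IrreducibleSpace (sub Z) := hemb.toHomeomorph.irreducibleSpace_iff.2 this
  exact isIntegral_of_irreducibleSpace_of_isReduced _

/-- The inclusion of reduced closed subschemes. -/
def subInclusion {Z W : Closeds X} (h : Z ≤ W) : sub Z ⟶ sub W :=
  Scheme.IdealSheafData.inclusion (Scheme.IdealSheafData.vanishingIdeal_antimono h)

theorem subInclusion_subι {Z W : Closeds X} (h : Z ≤ W) : subInclusion h ≫ subι W = subι Z :=
  Scheme.IdealSheafData.inclusion_subschemeι _

end Subschemes

/-! ### Local frames of invertible sheaves -/

section Frames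

variable {X : Scheme.{u}}

/-- The section `e` of `M` over `U` trivializes `M` on `U`. -/
def IsFrame (M : X.Modules) (U : X.Opens) (e : Γ(M, U)) : Prop :=
  ∀ (V : X.Opens) (h : V ≤ U), Function.Bijective
    (fun f : Γ(X, V) => (f • M.presheaf.map (homOfLE h).op e : Γ(M, V)))

theorem IsFrame.restrict {M : X.Modules} {U : X.Opens} {e : Γ(M, U)} (he : IsFrame M U e)
    {V : X.Opens} (h : V ≤ U) : IsFrame M V (M.presheaf.map (homOfLE h).op e) := by
  intro W hW
  have : M.presheaf.map (homOfLE hW).op (M.presheaf.map (homOfLE h).op e) =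
      M.presheaf.map (homOfLE (hW.trans h)).op e := by
    rw [← ConcreteCategory.comp_apply, ← Functor.map_comp]
    rfl
  rw [this]
  exact he W _

theorem restrict_opensι_smul (M : X.Modules) (U : X.Opens) (V : (U : Scheme.{u}).Opens)
    (f : Γ(X, U.ι ''ᵁ V)) (m : Γ(M, U.ι ''ᵁ V)) :
    (HSMul.hSMul (α := Γ((U : Scheme.{u}), V)) (β := Γ(M.restrict U.ι, V)) f m :
      Γ(M.restrict U.ι, V)) = f • m := by
  have := Scheme.Modules.smul_restrictAppIso_hom (f := U.ι) M V f
  rw [Scheme.Opens.ι_appIso] at this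
  exact ConcreteCategory.congr_hom this m

theorem IsInvertible.exists_isFrame {M : X.Modules} (hM : IsInvertible M) (x : X) :
    ∃ U : X.Opens, x ∈ U ∧ ∃ e : Γ(M, U), IsFrame M U e := by
  obtain ⟨U, hxU, ⟨ψ⟩⟩ := hM x
  -- The frame is the image of `1` under the trivialization. The open set is written `U.ι ''ᵁ ⊤`
  -- because sections of `M.restrict U.ι` over `⊤` are by definition sections of `M` there.
  refine ⟨U.ι ''ᵁ ⊤, by simpa using hxU, ψ.inv.app ⊤ (1 : Γ((U : Scheme.{u}), ⊤)), ?_⟩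
  intro V hV
  obtain ⟨V', rfl⟩ : ∃ V' : (U : Scheme.{u}).Opens, V = U.ι ''ᵁ V' := by
    refine ⟨U.ι ⁻¹ᵁ V, ?_⟩
    rw [Scheme.Opens.ι_image_top] at hV
    rw [Scheme.Hom.image_preimage_eq_opensRange_inf, Scheme.Opens.opensRange_ι, inf_eq_right.2 hV]
  have hbij := ConcreteCategory.bijective_of_isIso (ψ.inv.app V')
  refine Eq.subst (motive := fun g : Γ(X, U.ι ''ᵁ V') → Γ(M, U.ι ''ᵁ V') =>
    Function.Bijective g) (funext fun f => ?_) hbij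
  exact (hom_app_apply ψ.inv V' f).trans (restrict_opensι_smul M U V' f _)

theorem isInvertible_of_exists_isFrame {M : X.Modules}
    (hM : ∀ x : X, ∃ U : X.Opens, x ∈ U ∧ ∃ e : Γ(M, U), IsFrame M U e) : IsInvertible M := by
  intro x
  obtain ⟨U, hxU, e, he⟩ := hM x
  have hle : U.ι ''ᵁ ⊤ ≤ U := by simp
  refine ⟨U, hxU, ⟨(@asIso _ _ _ _ (homOfSection (M.restrict U.ι)
    (M.presheaf.map (homOfLE hle).op e)) ?_).symm⟩⟩
  rw [Scheme.Modules.Hom.isIso_iff_isIso_app]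
  intro V
  rw [ConcreteCategory.isIso_iff_bijective]
  refine Eq.subst (motive := fun g : Γ(X, U.ι ''ᵁ V) → Γ(M, U.ι ''ᵁ V) =>
    Function.Bijective g) (funext fun f => ?_)
    (he.restrict hle (U.ι ''ᵁ V) (U.ι.image_mono le_top))
  exact ((homOfSection_app (M.restrict U.ι) _ V f).trans (restrict_opensι_smul M U V f _)).symm

/-- Local injectivity becomes injectivity because `𝒪_X` is separated. The local coefficients of a
section are then unique, so they agree on overlaps and glue. This form suits sheafifications, whose
sections are only known locally. -/
theorem isFrame_of_locally {M : X.Modules} {U : X.Opens} {e : Γ(M, U)}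
    (hinj : ∀ (V : X.Opens) (h : V ≤ U) (f : Γ(X, V)), f • M.presheaf.map (homOfLE h).op e = 0 →
      ∀ x ∈ V, ∃ (W : X.Opens) (hW : W ≤ V), x ∈ W ∧ X.presheaf.map (homOfLE hW).op f = 0)
    (hsurj : ∀ (V : X.Opens) (h : V ≤ U) (s : Γ(M, V)), ∀ x ∈ V,
      ∃ (W : X.Opens) (hW : W ≤ V), x ∈ W ∧ ∃ f : Γ(X, W),
        f • M.presheaf.map (homOfLE (hW.trans h)).op e = M.presheaf.map (homOfLE hW).op s) :
    IsFrame M U e := by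
  have inj : ∀ (V : X.Opens) (h : V ≤ U), Function.Injective
      (fun f : Γ(X, V) => (f • M.presheaf.map (homOfLE h).op e : Γ(M, V))) := by
    intro V h f g hfg
    rw [← sub_eq_zero]
    have h0 : (f - g) • M.presheaf.map (homOfLE h).op e = 0 := by
      rw [sub_smul, sub_eq_zero]; exact hfg
    choose W hW hx hz using hinj V h _ h0
    refine X.sheaf.eq_of_locally_eq' (fun x : V => W x.1 x.2) V (fun x => homOfLE (hW x.1 x.2))
      (fun x hx' => Opens.mem_iSup.2 ⟨⟨x, hx'⟩, hx x hx'⟩) _ _ fun x => ?_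
    exact (hz x.1 x.2).trans (map_zero (X.presheaf.map (homOfLE (hW x.1 x.2)).op).hom).symm
  refine fun V h => ⟨inj V h, fun s => ?_⟩
  choose W hW hx f hf using hsurj V h s
  have mapmap : ∀ {A B C : X.Opens} (h₁ : A ≤ B) (h₂ : B ≤ C) (t : Γ(M, C)),
      M.presheaf.map (homOfLE h₁).op (M.presheaf.map (homOfLE h₂).op t) =
        M.presheaf.map (homOfLE (h₁.trans h₂)).op t := by
    intro A B C h₁ h₂ t
    rw [← ConcreteCategory.comp_apply, ← Functor.map_comp]
    rfl
  have res : ∀ (x : X) (hxV : x ∈ V) (A : X.Opens) (hA : A ≤ W x hxV),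
      X.presheaf.map (homOfLE hA).op (f x hxV) •
        M.presheaf.map (homOfLE (hA.trans ((hW x hxV).trans h))).op e =
          M.presheaf.map (homOfLE (hA.trans (hW x hxV))).op s := by
    intro x hxV A hA
    have := congrArg (M.presheaf.map (homOfLE hA).op) (hf x hxV)
    rwa [Scheme.Modules.map_smul, mapmap, mapmap] at this
  obtain ⟨g, hg, -⟩ := X.sheaf.existsUnique_gluing' (fun x : V => W x.1 x.2) V
    (fun x => homOfLE (hW x.1 x.2)) (fun x hx' => Opens.mem_iSup.2 ⟨⟨x, hx'⟩, hx x hx'⟩)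
    (fun x => f x.1 x.2) (by
      intro x y
      apply inj _ (inf_le_left.trans ((hW x.1 x.2).trans h))
      exact (res x.1 x.2 _ inf_le_left).trans (res y.1 y.2 _ inf_le_right).symm)
  refine ⟨g, ?_⟩
  refine TopCat.Sheaf.eq_of_locally_eq' ⟨M.presheaf, M.isSheaf⟩ (fun x : V => W x.1 x.2) V
    (fun x => homOfLE (hW x.1 x.2)) (fun x hx' => Opens.mem_iSup.2 ⟨⟨x, hx'⟩, hx x hx'⟩) _ _
    fun x => ?_
  change M.presheaf.map (homOfLE (hW x.1 x.2)).op _ = M.presheaf.map (homOfLE (hW x.1 x.2)).op s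
  refine (Scheme.Modules.map_smul M _ _ _).trans ?_
  rw [mapmap, ← hf x.1 x.2]
  exact congrArg (· • _) (hg x)

end Frames

/-! ### Invertible sheaves: sections on integral schemes, and pullbacks -/

section Invertible

variable {X Y : Scheme.{u}}

/-- In terms of the frame this is the injectivity of restriction of functions to a nonempty open
subset of an integral scheme. -/
theorem IsFrame.eq_zero_of_restrict_eq_zero [IsIntegral X] {M : X.Modules} {U : X.Opens}
    {e : Γ(M, U)} (he : IsFrame M U e) {V : X.Opens} (hV : V ≤ U) (m : Γ(M, V)) {W : X.Opens}
    (hW : W ≤ V) (hne : (W : Set X).Nonempty) (h : M.presheaf.map (homOfLE hW).op m = 0) :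
    m = 0 := by
  obtain ⟨f, rfl⟩ := (he V hV).2 m
  have h' := (Scheme.Modules.map_smul M (homOfLE hW) f _).symm.trans h
  rw [← ConcreteCategory.comp_apply, ← Functor.map_comp] at h'
  have h0 : X.presheaf.map (homOfLE hW).op f = 0 := by
    apply (he W (hW.trans hV)).1
    exact h'.trans (zero_smul _ _).symm
  have : Nonempty W := hne.to_subtype
  have : f = 0 := map_injective_of_isIntegral X (homOfLE hW) (h0.trans (map_zero _).symm)
  subst this
  exact zero_smul _ _

/-- A map into an invertible sheaf on an integral scheme is zero if it is zero on a nonempty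
open subset. -/
theorem eq_zero_of_restrict_eq_zero [IsIntegral X] {P M : X.Modules} (hM : IsInvertible M)
    (φ : P ⟶ M) (U : X.Opens) (hU : (U : Set X).Nonempty)
    (h : (Scheme.Modules.restrictFunctor U.ι).map φ = 0) : φ = 0 := by
  have hzero : ∀ W : X.Opens, W ≤ U → ∀ p : Γ(P, W), φ.app W p = 0 := by
    intro W hW p
    obtain ⟨W', rfl⟩ : ∃ W' : (U : Scheme.{u}).Opens, W = U.ι ''ᵁ W' := by
      refine ⟨U.ι ⁻¹ᵁ W, ?_⟩
      rw [Scheme.Hom.image_preimage_eq_opensRange_inf, Scheme.Opens.opensRange_ι,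
        inf_eq_right.2 hW]
    exact congrArg (fun c : P.restrict U.ι ⟶ M.restrict U.ι => c.app W' p) h
  apply Scheme.Modules.hom_ext
  intro V
  ext p
  change φ.app V p = 0
  choose W hxW e he using hM.exists_isFrame
  have nat : ∀ {A B : X.Opens} (hAB : A ≤ B) (q : Γ(P, B)),
      M.presheaf.map (homOfLE hAB).op (φ.app B q) = φ.app A (P.presheaf.map (homOfLE hAB).op q) :=
    fun hAB q => (ConcreteCategory.congr_hom (φ.mapPresheaf.naturality (homOfLE hAB).op) q).symm
  refine TopCat.Sheaf.eq_of_locally_eq' ⟨M.presheaf, M.isSheaf⟩ (fun x : V => W x.1 ⊓ V) V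
    (fun x => homOfLE inf_le_right)
    (fun x hx' => Opens.mem_iSup.2 ⟨⟨x, hx'⟩, hxW x, hx'⟩) _ _ fun x => ?_
  change M.presheaf.map (homOfLE inf_le_right).op (φ.app V p) =
    M.presheaf.map (homOfLE inf_le_right).op 0
  rw [map_zero, nat]
  refine (he x.1).eq_zero_of_restrict_eq_zero (V := W x.1 ⊓ V) (W := W x.1 ⊓ V ⊓ U) inf_le_left _
    inf_le_left ?_ ?_
  · exact nonempty_preirreducible_inter (W x.1 ⊓ V).isOpen U.isOpen ⟨x.1, hxW x.1, x.2⟩ hU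
  · rw [nat]
    exact hzero _ inf_le_right _

/-- The preimage of the whole space is the whole space, so terminal objects are preserved. Finality
is what makes the pullback of the structure sheaf the structure sheaf. -/
theorem final_opensMap {S T : TopCat.{u}} (g : S ⟶ T) : (Opens.map g).Final := by
  have := preservesTerminal_of_iso (Opens.map g)
    ((Opens.map g).mapIso (terminalIsTerminal.uniqueUpToIso isTerminalTop) ≪≫
      isTerminalTop.uniqueUpToIso terminalIsTerminal)
  infer_instance

theorem nonempty_pullback_structureSheaf_iso {S T : Scheme.{u}} (g : S ⟶ T) :
    Nonempty ((Scheme.Modules.pullback g).obj (structureSheaf T) ≅ structureSheaf S) := by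
  have h1 : (Opens.map g.base).Final := final_opensMap _
  have h2 : (SheafOfModules.pushforward.{u} g.toRingCatSheafHom).IsRightAdjoint :=
      (Scheme.Modules.pullbackPushforwardAdjunction g).isRightAdjoint
  have := @SheafOfModules.instIsIsoPullbackObjUnitToUnitOfFinal _ _ _ _ _ _ _ _ _ _
    g.toRingCatSheafHom h2 h1
  exact ⟨@asIso _ _ _ _
    (SheafOfModules.pullbackObjUnitToUnit g.toRingCatSheafHom) this⟩

theorem isInvertible_pullback (f : X ⟶ Y) {M : Y.Modules} (hM : IsInvertible M) :
    IsInvertible ((Scheme.Modules.pullback f).obj M) := by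
  intro x
  obtain ⟨U, hxU, ⟨ψ⟩⟩ := hM (f x)
  obtain ⟨u⟩ := nonempty_pullback_structureSheaf_iso (f ∣_ U)
  refine ⟨f ⁻¹ᵁ U, hxU, ⟨?_⟩⟩
  exact (Scheme.Modules.restrictFunctorIsoPullback _).app _ ≪≫
    (Scheme.Modules.pullbackComp _ _).app M ≪≫
    (Scheme.Modules.pullbackCongr (morphismRestrict_ι f U).symm).app M ≪≫
    ((Scheme.Modules.pullbackComp _ _).app M).symm ≪≫
    (Scheme.Modules.pullback (f ∣_ U)).mapIso
      (((Scheme.Modules.restrictFunctorIsoPullback U.ι).app M).symm ≪≫ ψ) ≪≫ u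

theorem isInvertible_structureSheaf : IsInvertible (structureSheaf X) := by
  intro x
  exact ⟨⊤, trivial, ⟨Scheme.Modules.restrictUnitIso _⟩⟩

end Invertible

/-! ### The inclusion `M(-D) ⟶ M` away from `D` -/

section Minus

variable {X Y : Scheme.{u}}

theorem isIso_kernelι_of_eq_zero {C : Type*} [Category* C] [HasZeroMorphisms C]
    {A B : C} {f : A ⟶ B} [HasKernel f] (hf : f = 0) : IsIso (kernel.ι f) := by
  subst hf
  infer_instance

theorem isIso_minusι_app (M : X.Modules) (D : Closeds X) (U : X.Opens)
    (h : Disjoint (U : Set X) D) : IsIso ((minusι M D).app U) := by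
  have hbot : subι D ⁻¹ᵁ U = ⊥ := by
    ext x
    simp only [Opens.coe_bot, Set.mem_empty_iff_false, iff_false]
    intro hx
    exact Set.disjoint_left.1 h hx (range_subι D ▸ Set.mem_range_self x)
  have hz : (restrMap M D).app U = 0 := by
    ext m
    let F : TopCat.Sheaf Ab (sub D) := ⟨(restr M D).presheaf, (restr M D).isSheaf⟩
    -- The preimage of `U` in `D` is empty, hence covered by the empty family, and a sheaf has only
    -- the zero section over it.
    have : ∀ s : Γ(restr M D, subι D ⁻¹ᵁ U), s = 0 := fun s =>
      F.eq_of_locally_eq' (fun x : Empty => nomatch x) _ (fun x => nomatch x)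
        (by rw [hbot]; exact bot_le) _ _ (fun x => nomatch x)
    exact this _
  -- Taking sections over `U` preserves kernels, and the kernel of a zero map is everything.
  let G : X.Modules ⥤ Ab := Scheme.Modules.toPresheaf X ⋙ (evaluation _ _).obj (Opposite.op U)
  have hG : G.map (restrMap M D) = 0 := hz
  have : G.PreservesZeroMorphisms := ⟨fun _ _ => rfl⟩
  have := preservesSmallestLimits_of_preservesLimits (Scheme.Modules.toPresheaf X)
  have : PreservesLimitsOfSize.{0, 0} ((evaluation (Opens X)ᵒᵖ Ab.{u}).obj (Opposite.op U)) :=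
    inferInstance
  have : PreservesLimit (parallelPair (restrMap M D) 0) G :=
    comp_preservesLimit (Scheme.Modules.toPresheaf X) _
  have h2 : IsIso (kernel.ι (G.map (restrMap M D))) := isIso_kernelι_of_eq_zero hG
  have h3 : IsIso (G.map (kernel.ι (restrMap M D))) := by
    rw [← kernelComparison_comp_ι (restrMap M D) G, ← PreservesKernel.iso_hom]
    infer_instance
  exact h3

/-- The morphism `f` factors through the open complement of `D`, where the inclusion is already an
isomorphism. -/
theorem isIso_pullback_map_minusι (f : Y ⟶ X) (M : X.Modules) (D : Closeds X)
    (h : Disjoint (Set.range f) D) : IsIso ((Scheme.Modules.pullback f).map (minusι M D)) := by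
  let U : X.Opens := D.compl
  have hr : IsIso ((Scheme.Modules.restrictFunctor U.ι).map (minusι M D)) := by
    rw [Scheme.Modules.Hom.isIso_iff_isIso_app]
    intro V
    refine isIso_minusι_app M D (U.ι ''ᵁ V) ?_
    rw [Set.disjoint_left]
    rintro _ ⟨y, -, rfl⟩ hD
    exact y.2 hD
  have hU : IsIso ((Scheme.Modules.pullback U.ι).map (minusι M D)) :=
    (NatIso.isIso_map_iff (Scheme.Modules.restrictFunctorIsoPullback U.ι) _).1 hr
  have hrange : Set.range f ⊆ Set.range U.ι := by
    rw [Scheme.Opens.range_ι]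
    exact fun x hx hD => Set.disjoint_left.1 h hx hD
  have := (NatIso.isIso_map_iff
    (Scheme.Modules.pullbackComp (IsOpenImmersion.lift U.ι f hrange) U.ι) (minusι M D)).1
    (by rw [Functor.comp_map]; infer_instance)
  rwa [IsOpenImmersion.lift_fac] at this

end Minus

/-! ### Tensor products of invertible sheaves -/

section Tensor

variable {X : Scheme.{u}}

-- This records all that is used about the sheafification defining `tensor`: a map from the presheaf
-- tensor product, compatible with restriction of pure tensors, locally injective on pure tensors
-- and locally surjective. Pure tensors suffice for injectivity, since multiples of `e ⊗ e'` are
-- pure.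
open TensorProduct in
theorem exists_tensor_toSheafify (M N : X.Modules) :
    ∃ η : ∀ V : X.Opens, Γ(M, V) ⊗[Γ(X, V)] Γ(N, V) →ₗ[Γ(X, V)] Γ(tensor M N, V),
      (∀ (V W : X.Opens) (h : W ≤ V) (m : Γ(M, V)) (n : Γ(N, V)),
        (tensor M N).presheaf.map (homOfLE h).op (η V (m ⊗ₜ n)) =
          η W (M.presheaf.map (homOfLE h).op m ⊗ₜ N.presheaf.map (homOfLE h).op n)) ∧
      (∀ (V : X.Opens) (m : Γ(M, V)) (n : Γ(N, V)), η V (m ⊗ₜ n) = 0 → ∀ x ∈ V,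
        ∃ (W : X.Opens) (h : W ≤ V), x ∈ W ∧
          M.presheaf.map (homOfLE h).op m ⊗ₜ[Γ(X, W)] N.presheaf.map (homOfLE h).op n = 0) ∧
      (∀ (V : X.Opens) (s : Γ(tensor M N, V)), ∀ x ∈ V,
        ∃ (W : X.Opens) (h : W ≤ V), x ∈ W ∧ ∃ p, η W p =
          (tensor M N).presheaf.map (homOfLE h).op s) := by
  let P : PresheafOfModules X.ringCatSheaf.obj :=
    PresheafOfModules.Monoidal.tensorObj (R := X.presheaf) M.val N.val
  let η := (PresheafOfModules.sheafificationAdjunction (𝟙 X.ringCatSheaf.obj)).unit.app P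
  let θ : P.presheaf ⟶ (tensor M N).presheaf :=
    CategoryTheory.toSheafify (Opens.grothendieckTopology X) P.presheaf
  have : Presheaf.IsLocallyInjective (Opens.grothendieckTopology X) θ :=
    inferInstanceAs (Presheaf.IsLocallyInjective (Opens.grothendieckTopology X)
      (CategoryTheory.toSheafify (Opens.grothendieckTopology X) P.presheaf))
  have : Presheaf.IsLocallySurjective (Opens.grothendieckTopology X) θ :=
    inferInstanceAs (Presheaf.IsLocallySurjective (Opens.grothendieckTopology X)
      (CategoryTheory.toSheafify (Opens.grothendieckTopology X) P.presheaf))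
  refine ⟨fun V => (η.app (.op V)).hom, ?_, ?_, ?_⟩
  · intro V W h m n
    exact (NatTrans.naturality_apply θ (homOfLE h).op (m ⊗ₜ[Γ(X, V)] n)).symm
  · intro V m n h0 x hx
    have h1 : θ.app (.op V) (m ⊗ₜ[Γ(X, V)] n) = θ.app (.op V) 0 :=
      Eq.trans h0 (map_zero (θ.app (.op V)).hom).symm
    obtain ⟨W, f, hf, hxW⟩ :=
      Presheaf.equalizerSieve_mem (Opens.grothendieckTopology X) θ _ _ h1 x hx
    refine ⟨W, f.le, hxW, ?_⟩
    exact Eq.trans hf (map_zero (P.presheaf.map f.op).hom)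
  · intro V s x hx
    obtain ⟨W, f, hf, hxW⟩ :=
      Presheaf.imageSieve_mem (Opens.grothendieckTopology X) θ (U := .op V) s x hx
    exact ⟨W, f.le, hxW, hf⟩

open TensorProduct in
theorem bijective_smul_tmul {R M N : Type*} [CommRing R] [AddCommGroup M] [AddCommGroup N]
    [Module R M] [Module R N] {e : M} {e' : N} (he : Function.Bijective fun r : R => r • e)
    (he' : Function.Bijective fun r : R => r • e') :
    Function.Bijective fun r : R => r • (e ⊗ₜ[R] e') := by
  let a : R ≃ₗ[R] M := LinearEquiv.ofBijective (LinearMap.toSpanSingleton R M e) he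
  let b : R ≃ₗ[R] N := LinearEquiv.ofBijective (LinearMap.toSpanSingleton R N e') he'
  have h := ((TensorProduct.lid R R).symm ≪≫ₗ TensorProduct.congr a b).bijective
  convert! h using 2 with r
  change r • (e ⊗ₜ[R] e') = ((1 : R) • e) ⊗ₜ[R] (r • e')
  rw [one_smul, TensorProduct.tmul_smul]

open TensorProduct in
theorem isInvertible_tensor {M N : X.Modules} (hM : IsInvertible M) (hN : IsInvertible N) :
    IsInvertible (tensor M N) := by
  obtain ⟨η, hres, hinj, hsurj⟩ := exists_tensor_toSheafify M N
  apply isInvertible_of_exists_isFrame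
  intro x
  obtain ⟨U₁, hx₁, e₁, he₁⟩ := hM.exists_isFrame x
  obtain ⟨U₂, hx₂, e₂, he₂⟩ := hN.exists_isFrame x
  obtain ⟨U, hx, e, e', he, he'⟩ : ∃ U : X.Opens, x ∈ U ∧ ∃ (e : Γ(M, U)) (e' : Γ(N, U)),
      IsFrame M U e ∧ IsFrame N U e' :=
    ⟨U₁ ⊓ U₂, ⟨hx₁, hx₂⟩, _, _, he₁.restrict inf_le_left, he₂.restrict inf_le_right⟩
  refine ⟨U, hx, η U (e ⊗ₜ e'), isFrame_of_locally ?_ ?_⟩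
  · intro V h f h0 y hy
    rw [hres, ← map_smul, TensorProduct.smul_tmul'] at h0
    obtain ⟨W, hW, hyW, hz⟩ := hinj V _ _ h0 y hy
    refine ⟨W, hW, hyW, ?_⟩
    rw [Scheme.Modules.map_smul, ← TensorProduct.smul_tmul', ← ConcreteCategory.comp_apply,
      ← ConcreteCategory.comp_apply, ← Functor.map_comp, ← Functor.map_comp] at hz
    exact (bijective_smul_tmul (he W (hW.trans h)) (he' W (hW.trans h))).1
      (hz.trans (zero_smul _ _).symm)
  · intro V h s y hy
    obtain ⟨W, hW, hyW, p, hp⟩ := hsurj V s y hy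
    obtain ⟨f, rfl⟩ := (bijective_smul_tmul (he W (hW.trans h)) (he' W (hW.trans h))).2 p
    refine ⟨W, hW, hyW, f, ?_⟩
    rw [hres, ← map_smul]
    exact hp

theorem isInvertible_tensorPow {M : X.Modules} (hM : IsInvertible M) (n : ℕ) :
    IsInvertible (tensorPow M n) := by
  induction n with
  | zero => exact isInvertible_structureSheaf
  | succ n ih => exact isInvertible_tensor ih hM

end Tensor

/-! ### Linking maps and vanishing on components -/

section Linking

variable {X : Scheme.{u}}

/-- Pulled back to any scheme over `Y` that avoids `Z`, a linking map for `Z` is an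
isomorphism. -/
theorem isIso_pullback_map_of_isLinkingMap {Z Y : Closeds X} {M N : X.Modules} {φ : M ⟶ N}
    (hφ : IsLinkingMap Z Y φ) {T : Scheme.{u}} (f : T ⟶ sub Y)
    (hf : Disjoint (Set.range f) (trace Y Z)) :
    IsIso ((Scheme.Modules.pullback f).map ((Scheme.Modules.pullback (subι Y)).map φ)) := by
  obtain ⟨e, j, hj, -, hφ⟩ := hφ
  let adj := Scheme.Modules.pullbackPushforwardAdjunction (subι Y)
  let m : restr M Y ⟶ restr N Y := e.hom ≫ minusι (restr N Y) (trace Y Z)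
  -- Both sides have the same transpose under the adjunction: the extension by zero `j`, restricted
  -- back to `Y`, is the inclusion of the twisted-down sheaf.
  have hm : (Scheme.Modules.pullback (subι Y)).map φ = m := by
    apply (adj.homEquiv M (restr N Y)).injective
    refine (adj.homEquiv_unit ..).trans (Eq.trans ?_ (adj.homEquiv_unit ..).symm)
    refine (adj.unit.naturality φ).symm.trans ?_
    change φ ≫ restrMap N Y = restrMap M Y ≫ extendMap m
    rw [hφ, Category.assoc, Category.assoc, hj]
    exact congrArg (restrMap M Y ≫ ·) (Functor.map_comp _ _ _).symm
  have := isIso_pullback_map_minusι f (restr N Y) (trace Y Z) hf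
  have : IsIso ((Scheme.Modules.pullback f).map m) := by
    rw [Functor.map_comp]
    infer_instance
  rw [hm]
  exact this

/-- A linking map for `Z` preserves and reflects the vanishing of sections on every integral
`W ⊆ Y` that is not contained in `Z`. -/
theorem restrMap_app_eq_zero_iff_of_isLinkingMap {Z Y W : Closeds X} (hWY : W ≤ Y)
    (hW : IsIrreducible (W : Set X)) (hWZ : ((W : Set X) \ Z).Nonempty) {M N : X.Modules}
    (hM : IsInvertible M) {φ : M ⟶ N} (hφ : IsLinkingMap Z Y φ) (s : Γ(M, ⊤)) :
    (restrMap M W).app ⊤ s = 0 ↔ (restrMap N W).app ⊤ (φ.app ⊤ s) = 0 := by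
  rw [restrMap_app_eq_zero_iff, restrMap_app_eq_zero_iff, ← homOfSection_comp, Functor.map_comp]
  refine ⟨fun h => by rw [h, zero_comp], fun h => ?_⟩
  rw [← Functor.map_comp] at h
  have := isIntegral_sub hW
  let U : (sub W).Opens := (trace W Z).compl
  have hU : (U : Set (sub W)).Nonempty := by
    obtain ⟨x, hxW, hxZ⟩ := hWZ
    rw [← range_subι W] at hxW
    obtain ⟨y, rfl⟩ := hxW
    exact ⟨y, hxZ⟩
  -- It is enough to treat `U = W \ Z`. There the pullback of `φ` is an isomorphism and can be
  -- cancelled.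
  refine eq_zero_of_restrict_eq_zero (isInvertible_pullback (subι W) hM) _ U hU ?_
  have hdisj : Disjoint (Set.range (U.ι ≫ subInclusion hWY)) (trace Y Z : Set (sub Y)) := by
    rw [Set.disjoint_left]
    rintro _ ⟨y, rfl⟩ (hy : subι Y ((U.ι ≫ subInclusion hWY) y) ∈ Z)
    have : subι Y ((U.ι ≫ subInclusion hWY) y) = subι W (U.ι y) := by
      rw [← subInclusion_subι hWY]
      simp
    rw [this] at hy
    exact y.2 hy
  have := isIso_pullback_map_of_isLinkingMap hφ _ hdisj
  rw [← restrict_map_eq_zero_iff, ← pullback_comp_map_eq_zero_iff, ← subInclusion_subι hWY,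
    ← Category.assoc, pullback_comp_map_eq_zero_iff]
  rw [← subInclusion_subι hWY, pullback_comp_map_eq_zero_iff] at h
  have h' := congrArg (Scheme.Modules.pullback U.ι).map h
  rw [Functor.map_zero, ← pullback_comp_map_eq_zero_iff, Functor.map_comp, Functor.map_comp] at h'
  rwa [← cancel_mono ((Scheme.Modules.pullback (U.ι ≫ subInclusion hWY)).map
    ((Scheme.Modules.pullback (subι Y)).map φ)), zero_comp]

end Linking

/-! ### The criterion on the curve -/

namespace Curve

variable {k : Type u} [Field k] (C : Curve k)

theorem Twists.isInvertible_sheaf {C : Curve k} (T : C.Twists) {L : C.X.Modules}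
    (hL : IsInvertible L) (d i l : ℕ) : IsInvertible (T.sheaf L d i l) :=
  isInvertible_tensor (isInvertible_tensor hL (isInvertible_tensorPow T.invertible₁ _))
    (isInvertible_tensorPow (isInvertible_tensor T.invertible₁ T.invertible₂) _)

variable {C} in
/-- The distributivity criterion for a linking map for `Z`, where `Z`, `W`, `W'` are the three
components in some order. -/
theorem distributesOver_iff_of_isLinkingMap {Z W W' : Closeds C.X}
    (hW : IsIrreducible (W : Set C.X)) (hWZ : ((W : Set C.X) \ Z).Nonempty)
    (hW' : IsIrreducible (W' : Set C.X)) (hWZ' : ((W' : Set C.X) \ Z).Nonempty)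
    {M N : C.X.Modules} (hM : IsInvertible M) {φ : M ⟶ N} (hφ : IsLinkingMap Z (W ⊔ W') φ)
    (r : ℕ) (V : Submodule k (C.H0 M)) (V' : Submodule k (C.H0 N))
    (hV : Module.finrank k V = r + 1) (hV' : Module.finrank k V' = r + 1)
    (hmap : V.map (C.H0map φ) = vanishing V' Z) :
    DistributesOver (vanishing V' Z) (vanishing V' W) (vanishing V' W') ↔
      (Module.finrank k ↥(vanishing V W ⊔ vanishing V W') : ℤ) -
          Module.finrank k ↥(vanishing V' W ⊔ vanishing V' W') =
        r + 1 - Module.finrank k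
          ↥(vanishing V' Z ⊔ vanishing V' W ⊔ vanishing V' W') := by
  -- `finrank` is `0` on infinite-dimensional spaces, so the value `r + 1` forces finite dimension.
  have : FiniteDimensional k V := Module.finite_of_finrank_pos (by omega)
  have : FiniteDimensional k V' := Module.finite_of_finrank_pos (by omega)
  have key : ∀ {S : Closeds C.X}, S ≤ W ⊔ W' → IsIrreducible (S : Set C.X) →
      ((S : Set C.X) \ Z).Nonempty →
      vanishing V S = V ⊓ (vanishing V' S).comap (C.H0map φ) := by
    intro S hS hirr hne
    ext s
    have hiff := restrMap_app_eq_zero_iff_of_isLinkingMap hS hirr hne hM hφ s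
    constructor
    · rintro ⟨hs, h0⟩
      -- Only the membership of the image in `V'` is taken from this.
      have hmem : C.H0map φ s ∈ vanishing V' Z := hmap ▸ Submodule.mem_map_of_mem hs
      exact ⟨hs, hmem.1, hiff.1 h0⟩
    · rintro ⟨hs, -, h0⟩
      exact ⟨hs, hiff.2 h0⟩
  have h := distributesOver_iff_finrank (C.H0map φ) V (vanishing V W) (vanishing V W') V'
    (vanishing V' Z) (vanishing V' W) (vanishing V' W') (hV.trans hV'.symm) inf_le_left
    inf_le_left inf_le_left hmap (key le_sup_left hW hWZ) (key le_sup_right hW' hWZ')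
  rw [hV] at h
  exact_mod_cast h

end Curve

end LimitLinear

end

open LimitLinear LimitLinear.Curve in
theorem mainTheorem5 {k : Type u} [Field k] (C : Curve k) (T : C.Twists)
    (L : C.X.Modules) (hL : IsInvertible L) (r d i l : ℕ) (hil : i + l ≤ d) :
    (0 < i →
      ∀ φ : T.sheaf L d i l ⟶ T.sheaf L d (i - 1) l,
        IsLinkingMap C.X₁ (C.X₂ ⊔ C.X₃) φ →
      ∀ (V : Submodule k (C.H0 (T.sheaf L d i l)))
        (V'' : Submodule k (C.H0 (T.sheaf L d (i - 1) l))),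
        Module.finrank k V = r + 1 → Module.finrank k V'' = r + 1 →
        V.map (C.H0map φ) = vanishing V'' C.X₁ →
        (Distributivity V'' ↔
          (Module.finrank k ↥(vanishing V C.X₂ ⊔ vanishing V C.X₃) : ℤ)
            - Module.finrank k ↥(vanishing V'' C.X₂ ⊔ vanishing V'' C.X₃)
          = r + 1 - Module.finrank k
              ↥(vanishing V'' C.X₁ ⊔ vanishing V'' C.X₂ ⊔ vanishing V'' C.X₃))) ∧
    (i + l + 1 ≤ d →
      ∀ φ : T.sheaf L d i (l + 1) ⟶ T.sheaf L d i l,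
        IsLinkingMap C.X₃ (C.X₁ ⊔ C.X₂) φ →
      ∀ (V : Submodule k (C.H0 (T.sheaf L d i l)))
        (V''' : Submodule k (C.H0 (T.sheaf L d i (l + 1)))),
        Module.finrank k V = r + 1 → Module.finrank k V''' = r + 1 →
        V'''.map (C.H0map φ) = vanishing V C.X₃ →
        (Distributivity V ↔
          (Module.finrank k ↥(vanishing V''' C.X₁ ⊔ vanishing V''' C.X₂) : ℤ)
            - Module.finrank k ↥(vanishing V C.X₁ ⊔ vanishing V C.X₂)
          = r + 1 - Module.finrank k
              ↥(vanishing V C.X₁ ⊔ vanishing V C.X₂ ⊔ vanishing V C.X₃))) := by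
  have hA := mem_of_vanishingIdeal_sup_eq _ C.inter₁₂
  have hB := mem_of_vanishingIdeal_sup_eq _ C.inter₂₃
  -- The node `B` witnesses that neither `X₂` nor `X₃` lies in `X₁`; the node `A` does the same for
  -- `X₁` and `X₂` relative to `X₃`.
  have h₃₁ : C.B ∉ C.X₁ := fun h => Set.disjoint_left.1 C.inter₁₃ h hB.2
  have h₁₃ : C.A ∉ C.X₃ := fun h => Set.disjoint_left.1 C.inter₁₃ hA.1 h
  refine ⟨fun _ φ hφ V V'' hV hV'' hmap => ?_, fun _ φ hφ V V''' hV hV''' hmap => ?_⟩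
  · exact distributesOver_iff_of_isLinkingMap C.irreducible₂ ⟨C.B, hB.1, h₃₁⟩
      C.irreducible₃ ⟨C.B, hB.2, h₃₁⟩ (T.isInvertible_sheaf hL _ _ _) hφ r V V'' hV hV'' hmap
  · have h := distributesOver_iff_of_isLinkingMap C.irreducible₁ ⟨C.A, hA.1, h₁₃⟩
      C.irreducible₂ ⟨C.A, hA.2, h₁₃⟩ (T.isInvertible_sheaf hL _ _ _) hφ r V''' V hV''' hV hmap
    rw [sup_assoc, sup_comm (vanishing V C.X₃)] at h
    -- `rotate` has order three on triples, so its inverse is `rotate` applied twice.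
    exact Iff.trans ⟨fun h => h.rotate, fun h => h.rotate.rotate⟩ h
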